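/- Let $\mathcal{G}=(\mathcal{V},\mathcal{E},W)$ be a directed network with node set $\mathcal{V}=\{1,\dots,n\}$, edge set $\mathcal{E}\subseteq\mathcal{V}\times\mathcal{V}$ and real adjacency matrix $W=[w_{ij}]\in\mathbb{R}^{n\times n}$, where $w_{ij}\neq 0$ if and only if $(i,j)\in\mathcal{E}$ ($W$ need not be symmetric). Assume that $\mathcal{G}$ is - signed: $w_{ij}<0$ for some $(i,j)\in\mathcal{E}$; - structurally balanced: $\mathcal{V}=\mathcal{V}_1\cup\mathcal{V}_2$ with $\mathcal{V}_1\cap\mathcal{V}_2=\emptyset$, where edges inside $\mathcal{V}_1$ or inside $\mathcal{V}_2$ have positive weight and edges between $\mathcal{V}_1$ and $\mathcal{V}_2$ have negative weight; - weight balanced: $\sum_{j=1}^n|w_{ij}|=\sum_{j=1}^n|w_{ji}|$ for every $i\in\mathcal{V}$; - connected: any two distinct nodes are reachable from one another via directed paths. Let $\mathcal{L}=[l_{ij}]$ be the signed Laplacian, $l_{ii}=\sum_{j=1}^n w_{ij}$ and $l_{ij}=-w_{ij}$ for $i\neq j$. For $\boldsymbol{k}\in\mathbb{R}^n$ put $\mathcal{L}^{\boldsymbol{k}}=\mathcal{L}+\mathrm{diag}\{\boldsymbol{k}\}$,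 and let $\boldsymbol{\delta}\in\mathbb{R}^n$ have the entries $\delta_i=\sum_{j=1}^n(|w_{ij}|-w_{ij})$. A matrix $M\in\mathbb{R}^{n\times n}$ is eventually exponentially positive if there is $m_0\in\mathbb{N}$ such that all entries of $e^{Mm}$ are positive for every integer $m\geq m_0$. Vector inequalities are entrywise. Then the following statements hold for every $\boldsymbol{k}\in\mathbb{R}^n$. 1) If $\boldsymbol{k}\leq\boldsymbol{\delta}$ and $\boldsymbol{k}\neq\boldsymbol{\delta}$, then $-\mathcal{L}^{\boldsymbol{k}}$ is not eventually exponentially positive. 2) If $\boldsymbol{k}\geq\boldsymbol{\delta}$ and $\boldsymbol{k}\neq\boldsymbol{\delta}$, then $-\mathcal{L}^{\boldsymbol{k}}$ is not eventually exponentially positive. -/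

import Mathlib

/-- A network on the node set `{1, …, n}` (here `Fin n`): an edge set of ordered pairs and a real
adjacency matrix whose nonzero entries are exactly the edges. -/
structure Network (n : ℕ) where
  edges : Set (Fin n × Fin n)
  W : Matrix (Fin n) (Fin n) ℝ
  W_ne_zero_iff : ∀ i j, W i j ≠ 0 ↔ (i, j) ∈ edges

namespace Network

variable {n : ℕ} (G : Network n)

/-- The network is signed: some edge carries a negative weight. -/
def IsSigned : Prop := ∃ i j, (i, j) ∈ G.edges ∧ G.W i j < 0

/-- Any two distinct nodes are reachable from one another along directed paths. -/
def IsConnected : Prop :=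
  ∀ i j, i ≠ j → Relation.TransGen (fun a b => (a, b) ∈ G.edges) i j

/-- `∑ j, |w i j| = ∑ j, |w j i|` at every node `i`. -/
def IsWeightBalanced : Prop := ∀ i, ∑ j, |G.W i j| = ∑ j, |G.W j i|

/-- The nodes split into two disjoint sets such that edges inside each set have positive weight and
edges between the two sets have negative weight. -/
def IsStructurallyBalanced : Prop :=
  ∃ V₁ V₂ : Set (Fin n), V₁ ∪ V₂ = Set.univ ∧ V₁ ∩ V₂ = ∅ ∧
    (∀ i j, (i, j) ∈ G.edges → (i ∈ V₁ ∧ j ∈ V₁) ∨ (i ∈ V₂ ∧ j ∈ V₂) → 0 < G.W i j) ∧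
    (∀ i j, (i, j) ∈ G.edges → (i ∈ V₁ ∧ j ∈ V₂) ∨ (i ∈ V₂ ∧ j ∈ V₁) → G.W i j < 0)

/-- The signed Laplacian: `l i i = ∑ k, w i k` and `l i j = - w i j` for `i ≠ j`. -/
def laplacian : Matrix (Fin n) (Fin n) ℝ :=
  Matrix.of fun i j => if i = j then ∑ k, G.W i k else - G.W i j

/-- The compensated Laplacian `L + diag k`. -/
def compensatedLaplacian (k : Fin n → ℝ) : Matrix (Fin n) (Fin n) ℝ :=
  G.laplacian + Matrix.diagonal k

/-- The vector with entries `∑ j, (|w i j| - w i j)`. -/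
def delta : Fin n → ℝ := fun i => ∑ j, (|G.W i j| - G.W i j)

end Network

/-- `M` is eventually exponentially positive: from some `m₀` on, all entries of the matrix
exponential `exp (m M)` are positive. -/
def IsEventuallyExponentiallyPositive {n : ℕ} (M : Matrix (Fin n) (Fin n) ℝ) : Prop :=
  ∃ m₀ : ℕ, ∀ m : ℕ, m₀ ≤ m → ∀ i j, 0 < NormedSpace.exp ((m : ℝ) • M) i j

/-! Structural balance gives signs `s i = ±1` such that, with D = diag(s), D W D is entrywise
nonnegative. Since `k` affects only the diagonal, D(-L^k)D has nonnegative off-diagonal entries, so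
its exponentials are nonnegative. Undoing the conjugation, each entry (i, j) of exp(-m L^k) has sign
`s i * s j` or vanishes, and at a negative edge that sign is -1. -/

/-- Matrices whose entries have the sign pattern `s i * s j` (or vanish). -/
def Matrix.HasSignPattern {n : ℕ} (s : Fin n → ℝ) (X : Matrix (Fin n) (Fin n) ℝ) : Prop :=
  ∀ i j, 0 ≤ s i * s j * X i j

namespace Matrix.HasSignPattern

variable {n : ℕ} {s : Fin n → ℝ} {X Y : Matrix (Fin n) (Fin n) ℝ}

theorem one : HasSignPattern s 1 := by
  intro i j
  by_cases h : i = j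
  · subst h
    simpa using mul_self_nonneg (s i)
  · simp [Matrix.one_apply_ne h]

theorem smul (hX : HasSignPattern s X) {c : ℝ} (hc : 0 ≤ c) : HasSignPattern s (c • X) := by
  intro i j
  rw [Matrix.smul_apply, smul_eq_mul, mul_left_comm]
  exact mul_nonneg hc (hX i j)

theorem mul (hs : ∀ i, s i * s i = 1) (hX : HasSignPattern s X) (hY : HasSignPattern s Y) :
    HasSignPattern s (X * Y) := by
  intro i j
  rw [Matrix.mul_apply, Finset.mul_sum]
  refine Finset.sum_nonneg fun l _ => ?_
  -- The factor `s l * s l = 1` is inserted at the intermediate index.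
  have h : s i * s j * (X i l * Y l j) = (s i * s l * X i l) * (s l * s j * Y l j) := by
    linear_combination (-(s i * s j * X i l * Y l j)) * hs l
  rw [h]
  exact mul_nonneg (hX i l) (hY l j)

theorem pow (hs : ∀ i, s i * s i = 1) (hX : HasSignPattern s X) (p : ℕ) :
    HasSignPattern s (X ^ p) := by
  induction p with
  | zero => simpa using one
  | succ p ih => simpa [pow_succ] using ih.mul hs hX

open scoped Matrix.Norms.Operator in
theorem exp (hs : ∀ i, s i * s i = 1) (hX : HasSignPattern s X) :
    HasSignPattern s (NormedSpace.exp X) := by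
  intro i j
  have hsum := NormedSpace.exp_series_hasSum_exp' (𝕂 := ℝ) X
  have hij := (Pi.hasSum.1 (Pi.hasSum.1 hsum i) j).mul_left (s i * s j)
  exact hij.nonneg fun p => (hX.pow hs p).smul (by positivity) i j

/-- It suffices to control the off-diagonal entries of the exponent. -/
theorem exp_of_offDiag (hs : ∀ i, s i * s i = 1) (hX : ∀ i j, i ≠ j → 0 ≤ s i * s j * X i j) :
    HasSignPattern s (NormedSpace.exp X) := by
  -- Shifting by a scalar matrix makes the diagonal nonnegative. It commutes with everything, so exp
  -- X = e^(-c) exp(c I + X).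
  obtain ⟨c, hc⟩ : ∃ c : ℝ, ∀ i, 0 ≤ c + X i i :=
    ⟨∑ i, |X i i|, fun i => by
      have h := Finset.single_le_sum (f := fun i => |X i i|) (fun i _ => abs_nonneg _)
        (Finset.mem_univ i)
      linarith [neg_abs_le (X i i)]⟩
  have hshift : HasSignPattern s (c • (1 : Matrix (Fin n) (Fin n) ℝ) + X) := by
    intro i j
    by_cases h : i = j
    · subst h
      simpa [hs i] using hc i
    · simpa [Matrix.one_apply_ne h] using hX i j h
  have hcomm : Commute (Matrix.diagonal fun _ : Fin n => -c)
      (c • (1 : Matrix (Fin n) (Fin n) ℝ) + X) := by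
    rw [← Matrix.smul_one_eq_diagonal]
    exact (Commute.one_left _).smul_left _
  have hX' : X = (Matrix.diagonal fun _ : Fin n => -c) +
      (c • (1 : Matrix (Fin n) (Fin n) ℝ) + X) := by
    rw [← Matrix.smul_one_eq_diagonal]
    module
  have hdiag : HasSignPattern s (NormedSpace.exp (Matrix.diagonal fun _ : Fin n => -c)) := by
    rw [Matrix.exp_diagonal]
    intro i j
    by_cases h : i = j
    · subst h
      simp [hs i, Pi.coe_exp, ← Real.exp_eq_exp_ℝ, Real.exp_nonneg]
    · simp [h]
  rw [hX', Matrix.exp_add_of_commute _ _ hcomm]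
  exact hdiag.mul hs (hshift.exp hs)

end Matrix.HasSignPattern

namespace Network

variable {n : ℕ} (G : Network n)

theorem neg_compensatedLaplacian_apply_ne (k : Fin n → ℝ) {i j : Fin n} (h : i ≠ j) :
    (-(G.compensatedLaplacian k)) i j = G.W i j := by
  simp [compensatedLaplacian, laplacian, h]

/-- A structurally balanced network admits signs on the nodes that are compatible with the
weights. -/
theorem IsStructurallyBalanced.exists_sign {G : Network n} (h : G.IsStructurallyBalanced) :
    ∃ s : Fin n → ℝ, (∀ i, s i * s i = 1) ∧ ∀ i j, 0 ≤ s i * s j * G.W i j := by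
  classical
  obtain ⟨V₁, V₂, hU, -, hpos, hneg⟩ := h
  have hV₂ : ∀ i, i ∉ V₁ → i ∈ V₂ := fun i hi =>
    (hU.symm ▸ Set.mem_univ i : i ∈ V₁ ∪ V₂).resolve_left hi
  refine ⟨fun i => if i ∈ V₁ then 1 else -1, fun i => ?_, fun i j => ?_⟩
  · dsimp only
    split_ifs <;> norm_num
  · by_cases hij : (i, j) ∈ G.edges
    · by_cases hi : i ∈ V₁ <;> by_cases hj : j ∈ V₁
      · simpa [hi, hj] using (hpos i j hij (.inl ⟨hi, hj⟩)).le
      · simpa [hi, hj] using (hneg i j hij (.inl ⟨hi, hV₂ j hj⟩)).le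
      · simpa [hi, hj] using (hneg i j hij (.inr ⟨hV₂ i hi, hj⟩)).le
      · simpa [hi, hj] using (hpos i j hij (.inr ⟨hV₂ i hi, hV₂ j hj⟩)).le
    · have h0 : G.W i j = 0 := by
        by_contra h0
        exact hij ((G.W_ne_zero_iff i j).1 h0)
      simp [h0]

/-- For a signed structurally balanced network, the exponentials of `-(L + diag k)` have a
nonpositive entry at every negative edge, whatever the compensation `k`. -/
theorem not_isEventuallyExponentiallyPositive {G : Network n} (hsigned : G.IsSigned)
    (hstruct : G.IsStructurallyBalanced) (k : Fin n → ℝ) :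
    ¬ IsEventuallyExponentiallyPositive (-(G.compensatedLaplacian k)) := by
  rintro ⟨m, hm⟩
  obtain ⟨i, j, -, hij⟩ := hsigned
  obtain ⟨s, hs, hW⟩ := hstruct.exists_sign
  have hexp : Matrix.HasSignPattern s
      (NormedSpace.exp ((m : ℝ) • -(G.compensatedLaplacian k))) := by
    refine Matrix.HasSignPattern.exp_of_offDiag hs fun a b hab => ?_
    rw [Matrix.smul_apply, G.neg_compensatedLaplacian_apply_ne k hab, smul_eq_mul, mul_left_comm]
    exact mul_nonneg m.cast_nonneg (hW a b)
  -- The negative edge and the positive exponential entry force opposite signs on `s i * s j`, so it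
  -- would be 0, yet its square is 1.
  have hle : s i * s j ≤ 0 := nonpos_of_mul_nonneg_left (hW i j) hij
  have hge : 0 ≤ s i * s j := nonneg_of_mul_nonneg_left (hexp i j) (hm m le_rfl i j)
  have hsq : (s i * s j) * (s i * s j) = 1 := by
    rw [mul_mul_mul_comm, hs i, hs j, one_mul]
  rw [le_antisymm hle hge] at hsq
  norm_num at hsq

end Network

theorem mainTheorem12 (n : ℕ) (G : Network n) (hsigned : G.IsSigned)
    (hstruct : G.IsStructurallyBalanced) (hweight : G.IsWeightBalanced)
    (hconn : G.IsConnected) (k : Fin n → ℝ) :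
    (k ≤ G.delta ∧ k ≠ G.delta →
      ¬ IsEventuallyExponentiallyPositive (-(G.compensatedLaplacian k))) ∧
    (G.delta ≤ k ∧ k ≠ G.delta →
      ¬ IsEventuallyExponentiallyPositive (-(G.compensatedLaplacian k))) :=
  ⟨fun _ => Network.not_isEventuallyExponentiallyPositive hsigned hstruct k,
    fun _ => Network.not_isEventuallyExponentiallyPositive hsigned hstruct k⟩
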